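/- For every integer $n \ge 26\,177\,082$ one has $n\in\mathcal S_3$, where $\mathcal S_3$ is the set of all sums $\mu_1+\mu_2+\mu_3$ of three positive integers with $\gcd(\mu_1,\mu_2,\mu_3)=1$ and $\gcd(\mu_i,\mu_j)>1$ for all $1\le i<j\le 3$. More precisely, let $p_j<p_k<p_l$ be the three smallest prime numbers that do not divide $n$. Then there are positive integers $x,y,z$ with $\gcd(x,y,z)=1$ such that $$n=p_jp_kx+p_jp_ly+p_kp_lz,$$ and the three summands $\mu_1=p_jp_kx$, $\mu_2=p_jp_ly$, $\mu_3=p_kp_lz$ satisfy $\gcd(\mu_1,\mu_2,\mu_3)=1$ and $\gcd(\mu_i,\mu_j)>1$ for all $1\le i<j\le 3$. -/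

import Mathlib

/-- The set `𝒮_s` of all sums `μ_1 + ⋯ + μ_s` of `s` positive integers whose greatest common
divisor is `1` while any two of them have a greatest common divisor exceeding `1`. -/
def sumsPairwiseNotCoprime (s : ℕ) : Set ℕ :=
  {n | ∃ μ : Fin s → ℕ, (∀ i, 0 < μ i) ∧ Finset.univ.gcd μ = 1 ∧
    (∀ i j, i ≠ j → 1 < Nat.gcd (μ i) (μ j)) ∧ n = ∑ i, μ i}

/-- The set of the prime numbers that do not divide `n`. -/
def primesNotDividing (n : ℕ) : Set ℕ :=
  {p | p.Prime ∧ ¬ p ∣ n}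

/-- `p`, `q`, `r` are, in this order, the smallest, the second smallest and the third smallest
prime number not dividing `n`. -/
def AreThreeSmallestPrimesNotDividing (n p q r : ℕ) : Prop :=
  IsLeast (primesNotDividing n) p ∧
  IsLeast (primesNotDividing n \ {p}) q ∧
  IsLeast (primesNotDividing n \ {p, q}) r

/-!
Let `p < q < r` be the three smallest primes not dividing `n`.

*Representations.* Solving `q * r * z ≡ n [MOD p]` with `1 ≤ z ≤ p` and then
`r * y ≡ (n - q * r * z) / p [MOD q]` with `1 ≤ y ≤ q` gives `n = p * q * x + p * r * y + q * r * z`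
with `z` small and `x` large. Trading `r` units of `x` for `q` units of `y` preserves the sum, and
as `r` is invertible modulo `z < r`, at most `z` such trades make `x ≡ 1 [MOD z]`, so that already
`x` and `z` are coprime. All this is possible as soon as `p * (p + 2) * q * r < n`
(`exists_pos_coprime_representation`).

*Size.* As `p + 2 ≤ r`, it is enough that `r ^ 4 ≤ n`. For `r ≤ 71` this follows from
`71 ^ 4 < 26177082`. For larger `r`, every prime below `r` other than `p` and `q` divides `n`, so
the primorial of `r - 1` divides `n * p * q`; by Bertrand's postulate this primorial is at least
`r ^ 6` (`pow_six_le_primorial`), and `p * q ≤ r ^ 2`.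

*Greatest common divisors.* A common prime factor of the three summands divides `n`, hence differs
from `p`, `q`, `r`, hence divides both `x` and `z`, which is impossible.
-/

/-! ### Representing `n` by products of two of three primes -/

/-- The congruence `a * y ≡ m [ZMOD b]`, for `a` invertible modulo `b`, has a solution among the
*positive* representatives `1, …, b`. -/
theorem exists_mem_Icc_dvd_sub_mul {a b : ℤ} (h : IsCoprime a b) (hb : 0 < b) (m : ℤ) :
    ∃ y : ℤ, 1 ≤ y ∧ y ≤ b ∧ b ∣ m - a * y := by
  obtain ⟨u, v, huv⟩ := h
  refine ⟨(u * m - 1) % b + 1, ?_, ?_, ?_⟩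
  · have := Int.emod_nonneg (u * m - 1) hb.ne'
    omega
  · have := Int.emod_lt_of_pos (u * m - 1) hb
    omega
  · refine ⟨v * m + a * ((u * m - 1) / b), ?_⟩
    have := Int.emod_add_mul_ediv (u * m - 1) b
    linear_combination (-a) * this - m * huv

theorem exists_pos_coprime_representation {p q r n : ℕ} (hp : p.Prime) (hq : q.Prime)
    (hr : r.Prime) (hpq : p < q) (hqr : q < r) (hn : p * (p + 2) * q * r < n) :
    ∃ x y z : ℕ, 0 < x ∧ 0 < y ∧ 0 < z ∧
      n = p * q * x + p * r * y + q * r * z ∧ Nat.Coprime x z := by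
  have cpq : Nat.Coprime p q := (Nat.coprime_primes hp hq).2 hpq.ne
  have cpr : Nat.Coprime p r := (Nat.coprime_primes hp hr).2 (hpq.trans hqr).ne
  have cqr : Nat.Coprime q r := (Nat.coprime_primes hq hr).2 hqr.ne
  have hp0 : (0 : ℤ) < p := by exact_mod_cast hp.pos
  have hq0 : (0 : ℤ) < q := by exact_mod_cast hq.pos
  have hr0 : (0 : ℤ) < r := by exact_mod_cast hr.pos
  obtain ⟨z, hz1, hzp, m, hm⟩ := exists_mem_Icc_dvd_sub_mul
    (a := ((q * r : ℕ) : ℤ)) (b := p) (Nat.isCoprime_iff_coprime.2 (cpq.mul_right cpr).symm) hp0 n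
  obtain ⟨y, hy1, hyq, x, hx⟩ := exists_mem_Icc_dvd_sub_mul
    (a := (r : ℤ)) (b := q) (Nat.isCoprime_iff_coprime.2 cqr.symm) hq0 m
  lift z to ℕ using by omega
  have crz : Nat.Coprime r z := Nat.coprime_of_lt_prime (by omega) (by omega) hr
  obtain ⟨j, hj1, hjz, k, hk⟩ := exists_mem_Icc_dvd_sub_mul
    (Nat.isCoprime_iff_coprime.2 crz) (by omega) (x - 1)
  push_cast at hm
  -- The bound on `n` leaves room for `j ≤ z ≤ p` trades.
  have hpos : 0 < x - r * j := by
    have hnz : (p * (p + 2) * q * r : ℤ) < n := by exact_mod_cast hn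
    have h1 : (r : ℤ) * y ≤ r * q := by gcongr
    have h2 : (q * r : ℤ) * z ≤ q * r * p := by gcongr
    have h3 : (r : ℤ) * j ≤ r * p := by gcongr; omega
    have h4 : (p : ℤ) * (q * r * (p + 1)) < p * m := by linarith
    have h5 := lt_of_mul_lt_mul_left h4 hp0.le
    have h6 : (q : ℤ) * (r * p) < q * x := by linarith
    have h7 := lt_of_mul_lt_mul_left h6 hq0.le
    linarith
  obtain ⟨x', hx'⟩ := Int.eq_ofNat_of_zero_le hpos.le
  have hy'pos : 0 < y + q * j := by positivity
  obtain ⟨y', hy'⟩ := Int.eq_ofNat_of_zero_le hy'pos.le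
  refine ⟨x', y', z, by omega, by omega, by omega, ?_, ?_⟩
  · zify
    rw [← hx', ← hy']
    linear_combination hm + p * hx
  · rw [← Nat.isCoprime_iff_coprime, ← hx']
    exact ⟨1, -k, by linear_combination hk⟩

/-! ### A lower bound for the primorial -/

/-- Halving `x` divides the left side by at most `2 ^ 6 = 64`, while the primorial loses a prime
above `x / 2` by Bertrand's postulate; this prime exceeds `64` once `128 ≤ x`. -/
theorem pow_six_le_primorial (x : ℕ) (hx : 64 ≤ x) : (x + 1) ^ 6 ≤ primorial x := by
  induction x using Nat.strong_induction_on with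
  | _ x ih =>
    rcases lt_or_ge x 128 with h | h
    · calc (x + 1) ^ 6 ≤ 128 ^ 6 := by gcongr; omega
        _ ≤ primorial 64 := by decide +kernel
        _ ≤ primorial x := primorial_mono hx
    · obtain ⟨m, hm⟩ : ∃ m, m = x / 2 := ⟨_, rfl⟩
      obtain ⟨p, hp, hmp, hpm⟩ := Nat.exists_prime_lt_and_le_two_mul m (by omega)
      have hdvd : p * primorial m ∣ primorial x := by
        refine Nat.Coprime.mul_dvd_of_dvd_of_dvd ?_ ?_ ?_
        · rw [hp.coprime_iff_not_dvd, hp.dvd_primorial_iff]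
          omega
        · rw [hp.dvd_primorial_iff]
          omega
        · exact primorial_dvd_primorial (by omega)
      calc (x + 1) ^ 6 ≤ (2 * (m + 1)) ^ 6 := by gcongr; omega
        _ = 64 * (m + 1) ^ 6 := by ring
        _ ≤ p * primorial m := Nat.mul_le_mul (by omega) (ih m (by omega) (by omega))
        _ ≤ primorial x := Nat.le_of_dvd (primorial_pos x) hdvd

/-! ### The three smallest primes not dividing `n` -/

theorem primesNotDividing_infinite {n : ℕ} (hn : n ≠ 0) : (primesNotDividing n).Infinite := by
  refine (Nat.infinite_setOfPred_prime.sdiff (Nat.divisors n).finite_toSet).mono ?_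
  rintro p ⟨hp, hpn⟩
  exact ⟨hp, fun h => hpn (by simpa [hn] using h)⟩

theorem exists_areThreeSmallestPrimesNotDividing {n : ℕ} (hn : n ≠ 0) :
    ∃ p q r, AreThreeSmallestPrimesNotDividing n p q r := by
  have key (S : Set ℕ) (hS : S.Nonempty) : ∃ a, IsLeast S a :=
    ⟨sInf S, Nat.sInf_mem hS, fun _ h => Nat.sInf_le h⟩
  have hinf := primesNotDividing_infinite hn
  obtain ⟨p, hp⟩ := key _ hinf.nonempty
  obtain ⟨q, hq⟩ := key _ (hinf.sdiff (Set.finite_singleton p)).nonempty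
  obtain ⟨r, hr⟩ := key _ (hinf.sdiff (Set.toFinite {p, q})).nonempty
  exact ⟨p, q, r, hp, hq, hr⟩

namespace AreThreeSmallestPrimesNotDividing

variable {n p q r : ℕ}

theorem lt_left (h : AreThreeSmallestPrimesNotDividing n p q r) : p < q :=
  lt_of_le_of_ne (h.1.2 h.2.1.1.1) fun e => h.2.1.1.2 e.symm

theorem lt_right (h : AreThreeSmallestPrimesNotDividing n p q r) : q < r :=
  lt_of_le_of_ne (h.2.1.2 ⟨h.2.2.1.1, fun e => h.2.2.1.2 (Or.inl e)⟩)
    fun e => h.2.2.1.2 (Or.inr e.symm)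

theorem dvd_of_prime_of_lt (h : AreThreeSmallestPrimesNotDividing n p q r) {t : ℕ}
    (ht : t.Prime) (htr : t < r) (htp : t ≠ p) (htq : t ≠ q) : t ∣ n := by
  by_contra hd
  have : r ≤ t := h.2.2.2 ⟨⟨ht, hd⟩, by simp [htp, htq]⟩
  omega

theorem primorial_dvd (h : AreThreeSmallestPrimesNotDividing n p q r) :
    primorial (r - 1) ∣ n * (p * q) := by
  refine Finset.prod_primes_dvd _ (fun t ht => ?_) (fun t ht => ?_) <;>
    simp only [Finset.mem_filter, Finset.mem_range] at ht
  · exact ht.2.prime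
  · by_cases htp : t = p
    · exact htp ▸ (dvd_mul_right t q).mul_left n
    by_cases htq : t = q
    · exact htq ▸ (dvd_mul_left t p).mul_left n
    · have := h.lt_right
      exact (h.dvd_of_prime_of_lt ht.2 (by omega) htp htq).mul_right _

theorem pow_four_le (h : AreThreeSmallestPrimesNotDividing n p q r) (hn : 26177082 ≤ n) :
    r ^ 4 ≤ n := by
  have hpq := h.lt_left
  have hqr := h.lt_right
  rcases le_or_gt r 71 with hr | hr
  · calc r ^ 4 ≤ 71 ^ 4 := by gcongr
      _ ≤ n := by omega
  · have hp := h.1.1.1.pos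
    have hle : r ^ 6 ≤ n * (p * q) := by
      have h6 := pow_six_le_primorial (r - 1) (by omega)
      rw [Nat.sub_add_cancel (by omega)] at h6
      exact h6.trans (Nat.le_of_dvd (by have : 0 < q := by omega
                                        positivity) h.primorial_dvd)
    refine Nat.le_of_mul_le_mul_right (c := r * r) ?_ (by positivity)
    calc r ^ 4 * (r * r) = r ^ 6 := by ring
      _ ≤ n * (p * q) := hle
      _ ≤ n * (r * r) := by gcongr; omega

end AreThreeSmallestPrimesNotDividing

/-! ### Greatest common divisors of the summands -/

theorem gcd_summands_eq_one {p q r x y z n : ℕ} (hp : p.Prime) (hq : q.Prime) (hr : r.Prime)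
    (hpn : ¬ p ∣ n) (hqn : ¬ q ∣ n) (hrn : ¬ r ∣ n)
    (h : n = p * q * x + p * r * y + q * r * z) (hxz : Nat.Coprime x z) :
    Nat.gcd (Nat.gcd (p * q * x) (p * r * y)) (q * r * z) = 1 := by
  by_contra hne
  obtain ⟨t, ht, htd⟩ := Nat.exists_prime_and_dvd hne
  obtain ⟨h12, h3⟩ := Nat.dvd_gcd_iff.1 htd
  obtain ⟨h1, h2⟩ := Nat.dvd_gcd_iff.1 h12
  have htn : t ∣ n := h ▸ dvd_add (dvd_add h1 h2) h3
  have hndvd {s : ℕ} (hs : s.Prime) (hsn : ¬ s ∣ n) : ¬ t ∣ s := fun hts =>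
    hsn ((Nat.prime_dvd_prime_iff_eq ht hs).1 hts ▸ htn)
  have hx : t ∣ x := by
    simpa [ht.dvd_mul, hndvd hp hpn, hndvd hq hqn] using h1
  have hz : t ∣ z := by
    simpa [ht.dvd_mul, hndvd hq hqn, hndvd hr hrn] using h3
  exact Nat.not_coprime_of_dvd_of_dvd ht.one_lt hx hz hxz

theorem one_lt_gcd_of_prime_dvd {t a b : ℕ} (ht : t.Prime) (ha : 0 < a) (hta : t ∣ a)
    (htb : t ∣ b) : 1 < Nat.gcd a b :=
  ht.one_lt.trans_le (Nat.le_of_dvd (Nat.gcd_pos_of_pos_left b ha) (Nat.dvd_gcd hta htb))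

theorem add_mem_sumsPairwiseNotCoprime {a b c : ℕ} (ha : 0 < a) (hb : 0 < b) (hc : 0 < c)
    (h : Nat.gcd (Nat.gcd a b) c = 1) (hab : 1 < Nat.gcd a b) (hac : 1 < Nat.gcd a c)
    (hbc : 1 < Nat.gcd b c) : a + b + c ∈ sumsPairwiseNotCoprime 3 := by
  refine ⟨![a, b, c], ?_, ?_, ?_, ?_⟩
  · simp [Fin.forall_fin_succ, ha, hb, hc]
  · refine Nat.dvd_one.1 ((Nat.dvd_gcd (Nat.dvd_gcd ?_ ?_) ?_).trans h.dvd)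
    · exact Finset.gcd_dvd (f := ![a, b, c]) (Finset.mem_univ 0)
    · exact Finset.gcd_dvd (f := ![a, b, c]) (Finset.mem_univ 1)
    · exact Finset.gcd_dvd (f := ![a, b, c]) (Finset.mem_univ 2)
  · simp [Fin.forall_fin_succ, hab, hac, hbc, Nat.gcd_comm b a, Nat.gcd_comm c a,
      Nat.gcd_comm c b]
  · simp [Fin.sum_univ_three]

theorem theorem2p8 (n : ℕ) (hn : 26177082 ≤ n) :
    n ∈ sumsPairwiseNotCoprime 3 ∧
    ∃ p q r : ℕ, AreThreeSmallestPrimesNotDividing n p q r ∧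
      ∃ x y z : ℕ, 0 < x ∧ 0 < y ∧ 0 < z ∧
        n = p * q * x + p * r * y + q * r * z ∧
        Nat.gcd (Nat.gcd x y) z = 1 ∧
        Nat.gcd (Nat.gcd (p * q * x) (p * r * y)) (q * r * z) = 1 ∧
        1 < Nat.gcd (p * q * x) (p * r * y) ∧
        1 < Nat.gcd (p * q * x) (q * r * z) ∧
        1 < Nat.gcd (p * r * y) (q * r * z) := by
  obtain ⟨p, q, r, h⟩ := exists_areThreeSmallestPrimesNotDividing (n := n) (by omega)
  have hpq := h.lt_left
  have hqr := h.lt_right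
  have ⟨hp, hpn⟩ := h.1.1
  have ⟨hq, hqn⟩ := h.2.1.1.1
  have ⟨hr, hrn⟩ := h.2.2.1.1
  have hp0 := hp.pos
  have hq0 := hq.pos
  have hr0 := hr.pos
  have hlt : p * (p + 2) * q * r < n := by
    refine lt_of_lt_of_le ?_ (h.pow_four_le hn)
    calc p * (p + 2) * q * r ≤ p * r * r * r := by gcongr; omega
      _ < r * r * r * r := by gcongr; omega
      _ = r ^ 4 := by ring
  obtain ⟨x, y, z, hx, hy, hz, hsum, hxz⟩ := exists_pos_coprime_representation hp hq hr hpq hqr hlt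
  have hgcd := gcd_summands_eq_one hp hq hr hpn hqn hrn hsum hxz
  have h12 : 1 < Nat.gcd (p * q * x) (p * r * y) :=
    one_lt_gcd_of_prime_dvd hp (by positivity) ⟨q * x, by ring⟩ ⟨r * y, by ring⟩
  have h13 : 1 < Nat.gcd (p * q * x) (q * r * z) :=
    one_lt_gcd_of_prime_dvd hq (by positivity) ⟨p * x, by ring⟩ ⟨r * z, by ring⟩
  have h23 : 1 < Nat.gcd (p * r * y) (q * r * z) :=
    one_lt_gcd_of_prime_dvd hr (by positivity) ⟨p * y, by ring⟩ ⟨q * z, by ring⟩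
  refine ⟨?_, p, q, r, h, x, y, z, hx, hy, hz, hsum, ?_, hgcd, h12, h13, h23⟩
  · rw [hsum]
    exact add_mem_sumsPairwiseNotCoprime (by positivity) (by positivity) (by positivity)
      hgcd h12 h13 h23
  · exact Nat.Coprime.coprime_dvd_left (Nat.gcd_dvd_left x y) hxz
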